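/- All groups are finite. For a group $G$ let $Z(G)$ be its center and $\mathrm{Cent}(G)=\{C_G(x):x\in G\}$ the set of centralizers of its elements. A CA-group is a non-abelian group in which $C_G(x)$ is abelian for every $x\in G\setminus Z(G)$. Write $[x,y]=x^{-1}y^{-1}xy$ and $[x,y,z]=[[x,y],z]$. For $0\le r\le n$, $n\geq 1$, let $$Q(n,r)=\langle a,b: a^{2^{n}}=b^{2^{r}}=1,\ a^{2^{n-r}}=[a,b]\rangle\quad\text{if } 2r\le n,$$ $$Q(n,r)=\langle a,b: a^{2^{n}}=b^{2^{r}}=1,\ a^{2^{r}}=[a,b]^{2^{2r-n}},\ [a,b,a]=[a,b,b]=1\rangle\quad\text{if } r\le n<2r,$$ and for $n\ge 1$ let $$R(n)=\langle a,b: a^{2^{n+1}}=b^{2^{n+1}}=1,\ a^{2^{n}}=[a,b]^{2^{n-1}}=b^{2^{n}},\ [a,b,a]=[a,b,b]=1\rangle .$$ A group $P$ has the central decomposition $H_1H_2\cdots H_k$ if it is generated by subgroups isomorphic to $H_1,\dots,H_k$, any two of which commute elementwise; $H^{\epsilon}$ stands for $\epsilon$ factors isomorphic to $H$. **Theorem.**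 Let $G$ be a finite non-abelian group with $|\mathrm{Cent}(G)|=|G|/|Z(G)|$ and with $Z(G)$ cyclic. Then: 1. $G=A\times P$, where $A$ is cyclic of odd order and $P$ is a $2$-group with cyclic center which has one of the central decompositions - $Q(n,0)\,Q(1,1)^{\epsilon}$ with $n>1$, $\epsilon\ge 1$; - $Q(n,1)\,Q(1,1)^{\epsilon}$ with $n>2$, $\epsilon\ge 0$; - $Q(1,1)^{\epsilon}$ with $\epsilon\ge 1$; - $R(1)\,Q(1,1)^{\epsilon}$ with $\epsilon\ge 0$. 2. If moreover $G$ is a CA-group, then $G=A\times P$, where $A$ is cyclic of odd order and $P$ is a $2$-group with cyclic center which has one of the central decompositions $Q(n,0)\,Q(1,1)$ with $n>1$; $Q(n,1)$ with $n>2$; $Q(1,1)$; $R(1)$. -/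

import Mathlib

namespace CentGroups

/-- The set `Cent(G)` of all centralizers `C_G(x)` of elements of `G`. -/
def Cent (G : Type*) [Group G] : Set (Subgroup G) :=
  Set.range fun x : G => Subgroup.centralizer {x}

/-- A group is non-abelian. -/
def NonAbelian (G : Type*) [Group G] : Prop :=
  ∃ x y : G, x * y ≠ y * x

/-- A CA-group: a non-abelian group in which the centralizer of every non-central element is
abelian. -/
def IsCAGroup (G : Type*) [Group G] : Prop :=
  NonAbelian G ∧ ∀ x : G, x ∉ Subgroup.center G →
    ∀ y ∈ Subgroup.centralizer {x}, ∀ z ∈ Subgroup.centralizer {x}, y * z = z * y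

/-- The commutator `[x, y] = x⁻¹ y⁻¹ x y`. -/
def comm {F : Type*} [Group F] (x y : F) : F := x⁻¹ * y⁻¹ * x * y

/-- The relators of a two-generator presentation. -/
abbrev Relators : Type := Set (FreeGroup (Fin 2))

/-- The first generator. -/
def a : FreeGroup (Fin 2) := FreeGroup.of 0

/-- The second generator. -/
def b : FreeGroup (Fin 2) := FreeGroup.of 1

/-- Relators of the group `Q(n, r)` for the prime `q`, where `r ≤ n`:
* if `2r ≤ n`: `a^(q^n) = b^(q^r) = 1`, `a^(q^(n-r)) = [a,b]`;
* if `r ≤ n < 2r`: `a^(q^n) = b^(q^r) = 1`, `a^(q^r) = [a,b]^(q^(2r-n))`,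
  `[a,b,a] = [a,b,b] = 1`. -/
def Q (q n r : ℕ) : Relators :=
  if 2 * r ≤ n then
    {a ^ q ^ n, b ^ q ^ r, a ^ q ^ (n - r) * (comm a b)⁻¹}
  else
    {a ^ q ^ n, b ^ q ^ r, a ^ q ^ r * (comm a b ^ q ^ (2 * r - n))⁻¹,
      comm (comm a b) a, comm (comm a b) b}

/-- Relators of the group `R(n)`, where `1 ≤ n`: `a^(2^(n+1)) = b^(2^(n+1)) = 1`,
`a^(2^n) = [a,b]^(2^(n-1)) = b^(2^n)`, `[a,b,a] = [a,b,b] = 1`. -/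
def R (n : ℕ) : Relators :=
  {a ^ 2 ^ (n + 1), b ^ 2 ^ (n + 1), a ^ 2 ^ n * (comm a b ^ 2 ^ (n - 1))⁻¹,
    comm a b ^ 2 ^ (n - 1) * (b ^ 2 ^ n)⁻¹, comm (comm a b) a, comm (comm a b) b}

/-- `P` is the (internal) central product of groups isomorphic to those presented by the entries
of the list `L`: there are subgroups of `P`, one for each entry of `L` and isomorphic to the group
it presents, which commute elementwise in pairs and together generate `P`. -/
def IsCentralProductOf (P : Type*) [Group P] (L : List Relators) : Prop :=
  ∃ H : Fin L.length → Subgroup P,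
    (∀ i, Nonempty (H i ≃* PresentedGroup (L.get i))) ∧
    (∀ i j, i ≠ j → ∀ x ∈ H i, ∀ y ∈ H j, x * y = y * x) ∧
    ⨆ i, H i = ⊤

/-- `G` is the internal direct product `A × P`, where `A` is cyclic of odd order and
`P` is a `2`-group with cyclic center. -/
def IsOddCyclicTimesTwoGroup {G : Type*} [Group G] (A P : Subgroup G) : Prop :=
  (A.Normal ∧ P.Normal ∧ IsCompl A P) ∧
    (IsCyclic A ∧ Odd (Nat.card A)) ∧
    (IsPGroup 2 P ∧ IsCyclic (Subgroup.center P))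

end CentGroups

/-! ### Recognising small 2-groups from their presentations. -/

namespace CentGroups

/-! The centralizer of `x` depends only on the coset `xZ(G)`, so `G/Z(G)` maps onto `Cent G`, and
the counting hypothesis makes this map injective. Since `x` and `x⁻¹` have the same centralizer,
every square is central (`mul_self_mem_center`); nothing else about the count is needed. Hence
commutators are central of order at most two. As the center is cyclic, its odd part splits off
against a Sylow 2-subgroup `P` (`exists_odd_times_two_group`), and every commutator of `P` is `1` or
the unique central involution `z`.

The commutator is thus a nondegenerate alternating form on the `𝔽₂`-space `P/Z(P)`, and `P` is built
from orthogonal hyperbolic planes `⟨u, v⟩` (`IsNondegenerate.exists_decomposition`). Squaring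
behaves as a quadratic map: `(xy)² = z x² y²` when `x`, `y` do not commute. If `|Z(P)| = 2`, each
plane can be made dihedral or quaternion, and two quaternion planes can be traded for dihedral ones.
If `|Z(P)| ≥ 4`, then `z` is a square in `Z(P)`, so squaring is linear modulo squares of central
elements; planes become dihedral or modular, and again at most one modular plane is needed.

In a CA-group two orthogonal nonabelian planes cannot coexist, which bounds the number of factors.
-/

lemma comm_eq_of_mul_eq {F : Type*} [Group F] {x y z : F} (hz : z ∈ Subgroup.center F)
    (h : x * y = z * (y * x)) : comm x y = z := by
  have h1 : x⁻¹ * y⁻¹ * (x * y) = z := by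
    rw [h, ← Subgroup.mem_center_iff.1 hz (y * x)]; group
  rw [← h1]; simp [comm, mul_assoc]

lemma mul_eq_mul_comm {F : Type*} [Group F] (x y : F) : x * y = y * x * comm x y := by
  simp only [comm]; group

/-- An element of a group generated by `α` and `β`, with `α²`, `β²` and `[α, β]` in a central
cyclic subgroup `⟨s⟩`, lies in one of the four cosets of `1`, `α`, `β`, `αβ`. -/
lemma exists_mem_zpowers_of_closure {Γ : Type*} [Group Γ] {α β s : Γ}
    (hgen : Subgroup.closure {α, β} = ⊤) (hs : s ∈ Subgroup.center Γ)
    (hα : α * α ∈ Subgroup.zpowers s) (hβ : β * β ∈ Subgroup.zpowers s)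
    (hαβ : comm α β ∈ Subgroup.zpowers s) (g : Γ) :
    ∃ t ∈ Subgroup.zpowers s, g = t ∨ g = α * t ∨ g = β * t ∨ g = α * β * t := by
  have hc : ∀ t ∈ Subgroup.zpowers s, ∀ g : Γ, g * t = t * g := fun t ht g =>
    Subgroup.mem_center_iff.1 ((Subgroup.zpowers_le.2 hs) ht) g
  have hA : ∀ x : Γ, (∃ t ∈ Subgroup.zpowers s, x = t ∨ x = α * t ∨ x = β * t ∨ x = α * β * t) →
      ∃ t ∈ Subgroup.zpowers s,
        α * x = t ∨ α * x = α * t ∨ α * x = β * t ∨ α * x = α * β * t := by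
    rintro x ⟨t, ht, rfl | rfl | rfl | rfl⟩
    · exact ⟨x, ht, .inr (.inl rfl)⟩
    · exact ⟨α * α * t, mul_mem hα ht, .inl (by group)⟩
    · exact ⟨t, ht, .inr (.inr (.inr (by group)))⟩
    · refine ⟨α * α * t, mul_mem hα ht, .inr (.inr (.inl ?_))⟩
      rw [← mul_assoc β, hc _ hα β]; group
  have hB : ∀ x : Γ, (∃ t ∈ Subgroup.zpowers s, x = t ∨ x = α * t ∨ x = β * t ∨ x = α * β * t) →
      ∃ t ∈ Subgroup.zpowers s,
        β * x = t ∨ β * x = α * t ∨ β * x = β * t ∨ β * x = α * β * t := by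
    have hba : β * α = α * β * (comm α β)⁻¹ := by rw [mul_eq_mul_comm α β]; group
    rintro x ⟨t, ht, rfl | rfl | rfl | rfl⟩
    · exact ⟨x, ht, .inr (.inr (.inl rfl))⟩
    · refine ⟨(comm α β)⁻¹ * t, mul_mem (inv_mem hαβ) ht, .inr (.inr (.inr ?_))⟩
      rw [← mul_assoc, hba]; group
    · exact ⟨β * β * t, mul_mem hβ ht, .inl (by group)⟩
    · refine ⟨β * β * (comm α β)⁻¹ * t, mul_mem (mul_mem hβ (inv_mem hαβ)) ht, .inr (.inl ?_)⟩
      rw [show β * (α * β * t) = β * α * (β * t) by group, hba,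
        show α * β * (comm α β)⁻¹ * (β * t) = α * β * ((comm α β)⁻¹ * β) * t by group,
        ← hc _ (inv_mem hαβ) β]
      group
  have hg : g ∈ Subgroup.closure {α, β} := hgen ▸ Subgroup.mem_top g
  have hS : ∀ t ∈ Subgroup.zpowers s, ∀ x : Γ,
      (∃ t ∈ Subgroup.zpowers s, x = t ∨ x = α * t ∨ x = β * t ∨ x = α * β * t) →
      ∃ t' ∈ Subgroup.zpowers s,
        t * x = t' ∨ t * x = α * t' ∨ t * x = β * t' ∨ t * x = α * β * t' := by
    rintro t ht x ⟨t', ht', h⟩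
    refine ⟨t' * t, mul_mem ht' ht, ?_⟩
    rw [← hc t ht x]
    rcases h with rfl | rfl | rfl | rfl <;> simp [mul_assoc]
  induction hg using Subgroup.closure_induction_left with
  | one => exact ⟨1, one_mem _, .inl rfl⟩
  | mul_left x hx y hy ih =>
    rcases hx with rfl | rfl
    · exact hA _ ih
    · exact hB _ ih
  | inv_mul_cancel x hx y hy ih =>
    rcases hx with rfl | rfl
    -- Inverses of generators need no separate analysis: `x⁻¹` is `x` up to a central element of
    -- `⟨s⟩`.
    · rw [show x⁻¹ * y = (x * x)⁻¹ * (x * y) by group]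
      exact hS _ (inv_mem hα) _ (hA _ ih)
    · rw [show x⁻¹ * y = (x * x)⁻¹ * (x * y) by group]
      exact hS _ (inv_mem hβ) _ (hB _ ih)

/-- Injectivity criterion for homomorphisms out of a two-generator group that is an extension of
a Klein four-group by a central cyclic subgroup. -/
lemma injective_of_closure {Γ P : Type*} [Group Γ] [Group P] (f : Γ →* P) {α β s : Γ}
    (hgen : Subgroup.closure {α, β} = ⊤) (hsα : α * s = s * α) (hsβ : β * s = s * β)
    (hα : α * α ∈ Subgroup.zpowers s) (hβ : β * β ∈ Subgroup.zpowers s)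
    (hαβ : comm α β ∈ Subgroup.zpowers s) (hord : s ^ orderOf (f s) = 1)
    (hne : f α * f β ≠ f β * f α) : Function.Injective f := by
  have hs : s ∈ Subgroup.center Γ := by
    have : Subgroup.closure {α, β} ≤ Subgroup.centralizer {s} := by
      rw [Subgroup.closure_le]
      rintro x (rfl | rfl) <;> simp [Subgroup.mem_centralizer_singleton_iff, *]
    rw [hgen] at this
    exact Subgroup.mem_center_iff.2 fun g =>
      Subgroup.mem_centralizer_singleton_iff.1 (this (Subgroup.mem_top g))
  rw [injective_iff_map_eq_one]
  intro g hg
  obtain ⟨t, ht, h⟩ := exists_mem_zpowers_of_closure hgen hs hα hβ hαβ g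
  have hc : ∀ g : Γ, f t * f g = f g * f t := fun g => by
    rw [← map_mul, ← map_mul, Subgroup.mem_center_iff.1 ((Subgroup.zpowers_le.2 hs) ht) g]
  -- In the last three cases `f α`, `f β` or `f α * f β` would be the inverse of `f t`, which
  -- commutes with the image, contradicting `hne`. So a kernel element lies in `⟨s⟩`, where `hord`
  -- says that `f` loses no order.
  rcases h with rfl | rfl | rfl | rfl
  · obtain ⟨k, rfl⟩ := Subgroup.mem_zpowers_iff.1 ht
    rw [map_zpow, ← orderOf_dvd_iff_zpow_eq_one] at hg
    obtain ⟨l, rfl⟩ := hg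
    rw [zpow_mul, zpow_natCast, hord, one_zpow]
  · rw [map_mul, mul_eq_one_iff_eq_inv] at hg
    refine absurd ?_ hne
    rw [hg]; exact ((show Commute (f t) (f β) from hc β).inv_left).eq
  · rw [map_mul, mul_eq_one_iff_eq_inv] at hg
    refine absurd ?_ hne
    rw [hg]; exact ((show Commute (f t) (f α) from hc α).inv_left).eq.symm
  · rw [map_mul, mul_eq_one_iff_eq_inv, map_mul] at hg
    refine absurd ?_ hne
    have h1 : f α * f β * f α = f α * (f α * f β) := by
      rw [hg]; exact ((show Commute (f t) (f α) from hc α).inv_left).eq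
    rw [mul_assoc] at h1
    exact (mul_left_cancel h1).symm

lemma presentedGroup_closure (r : Relators) :
    Subgroup.closure {PresentedGroup.mk r a, PresentedGroup.mk r b} = ⊤ := by
  rw [← PresentedGroup.closure_range_of r]
  congr 1
  ext x
  simp [Fin.exists_fin_two, PresentedGroup.of, a, b, eq_comm]

lemma presentedGroup_mk_eq_one {r s : Relators} (h : r = s) :
    ∀ w ∈ s, PresentedGroup.mk r w = 1 :=
  fun _ hw => PresentedGroup.one_of_mem (h ▸ hw)

lemma map_comm {F F' : Type*} [Group F] [Group F'] (f : F →* F') (x y : F) :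
    f (comm x y) = comm (f x) (f y) := by simp [comm]

lemma comm_eq_one_iff {F : Type*} [Group F] {x y : F} : comm x y = 1 ↔ x * y = y * x := by
  rw [mul_eq_mul_comm x y]; simp

/-- Elements `x`, `y` satisfying the relators `r` generate a copy of the presented group, provided
the canonical homomorphism is injective. -/
lemma exists_hom_of_relators {P : Type*} [Group P] (r : Relators) (x y : P)
    (h : ∀ w ∈ r, FreeGroup.lift ![x, y] w = 1) :
    ∃ f : PresentedGroup r →* P, f (PresentedGroup.mk r a) = x ∧ f (PresentedGroup.mk r b) = y ∧
      (Function.Injective f → Nonempty (Subgroup.closure {x, y} ≃* PresentedGroup r)) := by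
  refine ⟨PresentedGroup.toGroup h, ?_, ?_, fun hf => ?_⟩
  · exact (PresentedGroup.toGroup.of h).trans rfl
  · exact (PresentedGroup.toGroup.of h).trans rfl
  · have : (PresentedGroup.toGroup h).range = Subgroup.closure {x, y} := by
      rw [MonoidHom.range_eq_map, ← presentedGroup_closure, MonoidHom.map_closure,
        Set.image_pair]
      congr 2
      · exact (PresentedGroup.toGroup.of h).trans rfl
      · congr 1; exact (PresentedGroup.toGroup.of h).trans rfl
    rw [← this]
    exact ⟨(MonoidHom.ofInjective hf).symm⟩

@[simp] lemma lift_a {P : Type*} [Group P] (x y : P) : FreeGroup.lift ![x, y] a = x := by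
  simp [a]

@[simp] lemma lift_b {P : Type*} [Group P] (x y : P) : FreeGroup.lift ![x, y] b = y := by
  simp [b]

/-- Two non-commuting involutions with central commutator generate the dihedral group of order
eight. -/
lemma closure_equiv_dihedral {P : Type*} [Group P] {x y z : P} (hz : z ∈ Subgroup.center P)
    (hz2 : z * z = 1) (hx : x * x = 1) (hy : y * y = 1) (hxy : x * y = z * (y * x))
    (hne : x * y ≠ y * x) : Nonempty (Subgroup.closure {x, y} ≃* PresentedGroup (Q 2 1 1)) := by
  have hc := comm_eq_of_mul_eq hz hxy
  have hzc := Subgroup.mem_center_iff.1 hz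
  have hQ : Q 2 1 1 = {a ^ 2, b ^ 2, a ^ 2 * (comm a b ^ 2)⁻¹, comm (comm a b) a,
      comm (comm a b) b} := by simp [Q]
  obtain ⟨f, hfa, hfb, h⟩ := exists_hom_of_relators (Q 2 1 1) x y (by
    rw [hQ]
    rintro w (rfl | rfl | rfl | rfl | rfl) <;>
    simp [map_comm, hc, hx, hy, -mul_inv_rev, hz2, pow_two, comm_eq_one_iff, hzc])
  refine h ?_
  have hrel := presentedGroup_mk_eq_one hQ
  simp only [Set.mem_insert_iff, Set.mem_singleton_iff, forall_eq_or_imp, forall_eq, map_mul,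
    map_pow, map_comm, map_inv, comm_eq_one_iff] at hrel
  obtain ⟨h1, h2, h3, h4, h5⟩ := hrel
  refine injective_of_closure f (presentedGroup_closure _) h4.symm h5.symm
    (by rw [← pow_two, h1]; exact one_mem _) (by rw [← pow_two, h2]; exact one_mem _)
    (Subgroup.mem_zpowers _) ?_ (by rwa [hfa, hfb])
  rw [map_comm, hfa, hfb, hc, orderOf_eq_prime (p := 2)]
  -- The relator `a² = [a,b]²` together with `a² = 1` bounds the order of the commutator.
  · rw [h1, one_mul, inv_eq_one] at h3; exact h3
  · rw [pow_two, hz2]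
  · rintro rfl; exact hne (by simpa using hxy)

/-- Two non-commuting elements with equal squares and commutator, an involution, generate the
quaternion group of order eight. -/
lemma closure_equiv_quaternion {P : Type*} [Group P] {x y z : P} (hz : z ∈ Subgroup.center P)
    (hz2 : z * z = 1) (hx : x * x = z) (hy : y * y = z) (hxy : x * y = z * (y * x))
    (hne : x * y ≠ y * x) : Nonempty (Subgroup.closure {x, y} ≃* PresentedGroup (R 1)) := by
  have hc := comm_eq_of_mul_eq hz hxy
  have hzc := Subgroup.mem_center_iff.1 hz
  have hx4 : x ^ 4 = 1 := by rw [show 4 = 2 * 2 from rfl, pow_mul, pow_two x, hx, pow_two, hz2]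
  have hy4 : y ^ 4 = 1 := by rw [show 4 = 2 * 2 from rfl, pow_mul, pow_two y, hy, pow_two, hz2]
  have hR : R 1 = {a ^ 4, b ^ 4, a ^ 2 * (comm a b)⁻¹, comm a b * (b ^ 2)⁻¹, comm (comm a b) a,
      comm (comm a b) b} := by simp [R]
  obtain ⟨f, hfa, hfb, h⟩ := exists_hom_of_relators (R 1) x y (by
    rw [hR]
    rintro w (rfl | rfl | rfl | rfl | rfl | rfl) <;>
    simp [map_comm, hc, hx, hy, hx4, hy4, pow_two, comm_eq_one_iff, hzc, -mul_inv_rev])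
  refine h ?_
  have hrel := presentedGroup_mk_eq_one hR
  simp only [Set.mem_insert_iff, Set.mem_singleton_iff, forall_eq_or_imp, forall_eq, map_mul,
    map_pow, map_comm, map_inv, comm_eq_one_iff] at hrel
  obtain ⟨h1, h2, h3, h4, h5, h6⟩ := hrel
  rw [mul_inv_eq_one] at h3 h4
  refine injective_of_closure f (presentedGroup_closure _) h5.symm h6.symm
    (by rw [← pow_two, h3]; exact Subgroup.mem_zpowers _)
    (by rw [← pow_two, ← h4]; exact Subgroup.mem_zpowers _)
    (Subgroup.mem_zpowers _) ?_ (by rwa [hfa, hfb])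
  rw [map_comm, hfa, hfb, hc, orderOf_eq_prime (p := 2)]
  · rw [← h3, ← pow_mul, h1]
  · rw [pow_two, hz2]
  · rintro rfl; exact hne (by simpa using hxy)

/-- Generators of the modular maximal-cyclic group of order `2 ^ (m + 2)`. -/
lemma closure_equiv_modular {P : Type*} [Group P] {x y z : P} {m : ℕ} (hm : 1 ≤ m)
    (hz : z ∈ Subgroup.center P) (hx : orderOf (x * x) = 2 ^ m) (hxz : x ^ 2 ^ m = z)
    (hy : y * y = 1) (hxy : x * y = z * (y * x))
    (hne : x * y ≠ y * x) :
    Nonempty (Subgroup.closure {x, y} ≃* PresentedGroup (Q 2 (m + 1) 1)) := by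
  have hc := comm_eq_of_mul_eq hz hxy
  have hQ : Q 2 (m + 1) 1 = {a ^ 2 ^ (m + 1), b ^ 2, a ^ 2 ^ m * (comm a b)⁻¹} := by
    have : 2 * 1 ≤ m + 1 := by omega
    simp [Q, this]
  obtain ⟨f, hfa, hfb, h⟩ := exists_hom_of_relators (Q 2 (m + 1) 1) x y (by
    rw [hQ]
    rintro w (rfl | rfl | rfl)
    · simp [pow_succ', pow_mul, ← hx, pow_orderOf_eq_one]
    · simp [pow_two, hy]
    · simp [map_comm, hc, hxz])
  refine h ?_
  have hrel := presentedGroup_mk_eq_one hQ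
  simp only [Set.mem_insert_iff, Set.mem_singleton_iff, forall_eq_or_imp, forall_eq, map_mul,
    map_pow, map_comm, map_inv] at hrel
  obtain ⟨h1, h2, h3⟩ := hrel
  rw [mul_inv_eq_one] at h3
  set α := PresentedGroup.mk (Q 2 (m + 1) 1) a
  set β := PresentedGroup.mk (Q 2 (m + 1) 1) b
  have hcα : comm α β * α = α * comm α β := by rw [← h3, ← pow_succ, ← pow_succ']
  have h4 : α * β = β * (α * comm α β) := by rw [mul_eq_mul_comm α β, mul_assoc]
  have hc2 : comm α β * comm α β = 1 := by rw [← h3, ← pow_add, ← two_mul, ← pow_succ', h1]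
  -- The central cyclic subgroup is now `⟨α²⟩`: it commutes with `β` because the commutator squares
  -- to one, and it contains the commutator `α ^ 2 ^ m` because `1 ≤ m`.
  refine injective_of_closure f (s := α * α) (presentedGroup_closure _) (mul_assoc ..).symm ?_
    (Subgroup.mem_zpowers _)
    (by rw [← pow_two β, h2]; exact one_mem _) ?_ ?_ (by rwa [hfa, hfb])
  · rw [mul_assoc α α β, h4, ← mul_assoc α β, h4, mul_assoc β, mul_assoc α,
      ← mul_assoc (comm α β), hcα, mul_assoc α (comm α β), hc2, mul_one]
  · obtain ⟨k, rfl⟩ := Nat.exists_eq_add_of_le' hm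
    rw [← h3, pow_succ', pow_mul, pow_two]
    exact Subgroup.npow_mem_zpowers _ _
  · rw [map_mul, hfa, hx, ← pow_two, ← pow_mul, ← pow_succ', h1]

/-- For `r = 0` the relator `b ^ 2 ^ 0` kills `b`, and what remains is cyclic. -/
lemma zpowers_equiv_cyclic {P : Type*} [Group P] {c : P} {m : ℕ} (hc : orderOf c = 2 ^ m) :
    Nonempty (Subgroup.zpowers c ≃* PresentedGroup (Q 2 m 0)) := by
  have hQ : Q 2 m 0 = {a ^ 2 ^ m, b, a ^ 2 ^ m * (comm a b)⁻¹} := by simp [Q]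
  obtain ⟨f, hfa, hfb, h⟩ := exists_hom_of_relators (Q 2 m 0) c 1 (by
    rw [hQ]
    rintro w (rfl | rfl | rfl) <;> simp [comm, ← hc, pow_orderOf_eq_one])
  have hcl : Subgroup.closure {c, 1} = Subgroup.zpowers c := by
    rw [Set.pair_comm, Subgroup.closure_insert_one, Subgroup.zpowers_eq_closure]
  rw [hcl] at h
  refine h ?_
  have hrel := presentedGroup_mk_eq_one hQ
  simp only [Set.mem_insert_iff, Set.mem_singleton_iff, forall_eq_or_imp, forall_eq, map_mul,
    map_pow, map_comm, map_inv] at hrel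
  obtain ⟨h1, h2, -⟩ := hrel
  rw [injective_iff_map_eq_one]
  intro g hg
  have hgen := presentedGroup_closure (Q 2 m 0)
  rw [h2, Set.pair_comm, Subgroup.closure_insert_one, ← Subgroup.zpowers_eq_closure] at hgen
  obtain ⟨k, rfl⟩ := Subgroup.mem_zpowers_iff.1 (hgen ▸ Subgroup.mem_top g)
  rw [map_zpow, hfa, ← orderOf_dvd_iff_zpow_eq_one, hc] at hg
  obtain ⟨l, rfl⟩ := hg
  rw [zpow_mul, zpow_natCast, h1, one_zpow]

end CentGroups

namespace CentGroups

/-! ### Central decompositions of subgroups -/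

/-- The subgroup `K` is the central product of groups presented by the entries of `L`. -/
def HasCentralDecomposition {P : Type*} [Group P] (K : Subgroup P) (L : List Relators) : Prop :=
  ∃ H : Fin L.length → Subgroup P,
    (∀ i, Nonempty (H i ≃* PresentedGroup (L.get i))) ∧
    (∀ i j, i ≠ j → ∀ x ∈ H i, ∀ y ∈ H j, x * y = y * x) ∧
    ⨆ i, H i = K

lemma hasCentralDecomposition_nil {P : Type*} [Group P] :
    HasCentralDecomposition (⊥ : Subgroup P) [] :=
  ⟨fun i => i.elim0, fun i => i.elim0, fun i => i.elim0, iSup_of_empty (ι := Fin 0) _⟩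

lemma HasCentralDecomposition.cons {P : Type*} [Group P] {K H : Subgroup P} {L : List Relators}
    {r : Relators} (hK : HasCentralDecomposition K L) (hH : Nonempty (H ≃* PresentedGroup r))
    (hc : ∀ x ∈ H, ∀ y ∈ K, x * y = y * x) : HasCentralDecomposition (H ⊔ K) (r :: L) := by
  obtain ⟨F, h1, h2, rfl⟩ := hK
  refine ⟨Fin.cons (α := fun _ => Subgroup P) H F, ?_, ?_, ?_⟩
  · intro i
    refine Fin.cases ?_ (fun j => ?_) i
    · exact hH
    · exact h1 j
  · intro i j
    refine Fin.cases ?_ (fun i => ?_) i <;> refine Fin.cases ?_ (fun j => ?_) j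
    · exact fun h => absurd rfl h
    · exact fun _ x hx y hy => hc x hx y (Subgroup.mem_iSup_of_mem j hy)
    · exact fun _ x hx y hy => (hc y hy x (Subgroup.mem_iSup_of_mem i hx)).symm
    · exact fun h => h2 i j fun hij => h (by rw [hij])
  · refine le_antisymm (iSup_le fun i => ?_) (sup_le ?_ (iSup_le fun j => ?_))
    · refine Fin.cases ?_ (fun j => ?_) i
      · exact le_sup_left
      · exact le_sup_of_le_right (le_iSup F j)
    · exact le_iSup (Fin.cons (α := fun _ => Subgroup P) H F) 0
    · exact le_iSup (Fin.cons (α := fun _ => Subgroup P) H F) j.succ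

/-! ### Groups with a commutator subgroup of order two -/

/-- All commutators of `P` are trivial or equal to the central element `z`, where `z² = 1`. -/
structure CommutatorsIn (P : Type*) [Group P] (z : P) : Prop where
  mem_center : z ∈ Subgroup.center P
  mul_self : z * z = 1
  mul_eq : ∀ x y : P, x * y = y * x ∨ x * y = z * (y * x)

/-- Two pairs of non-commuting elements, each element of one pair commuting with each element of
the other pair. -/
def HasCommutingNonabelianPairs (P : Type*) [Group P] : Prop :=
  ∃ u v x y : P, u * v ≠ v * u ∧ x * y ≠ y * x ∧ Commute u x ∧ Commute u y ∧ Commute v x ∧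
    Commute v y

namespace CommutatorsIn

variable {P : Type*} [Group P] {z : P}

lemma comm_z (hP : CommutatorsIn P z) (g : P) : g * z = z * g :=
  Subgroup.mem_center_iff.1 hP.mem_center g

lemma twist_of_ne (hP : CommutatorsIn P z) {x y : P} (h : x * y ≠ y * x) :
    x * y = z * (y * x) := (hP.mul_eq x y).resolve_left h

lemma ne_of_twist (hz : z ≠ 1) {x y : P} (h : x * y = z * (y * x)) :
    x * y ≠ y * x := by
  rw [h]; simpa using hz

lemma twist_symm (hP : CommutatorsIn P z) {x y : P} (h : x * y = z * (y * x)) :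
    y * x = z * (x * y) := by
  rw [h, ← mul_assoc, hP.mul_self, one_mul]

lemma commute_mul (hP : CommutatorsIn P z) {x y u : P} (hx : x * u = z * (u * x))
    (hy : y * u = z * (u * y)) : Commute (x * y) u := by
  show x * y * u = u * (x * y)
  rw [mul_assoc, hy, ← mul_assoc, hP.comm_z, mul_assoc, ← mul_assoc x, hx, mul_assoc z,
    ← mul_assoc z z, hP.mul_self, one_mul, mul_assoc]

lemma twist_mul_right (hP : CommutatorsIn P z) {x y u : P} (hx : Commute x u)
    (hy : y * u = z * (u * y)) : x * y * u = z * (u * (x * y)) := by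
  rw [mul_assoc, hy, ← mul_assoc, hP.comm_z, mul_assoc, ← mul_assoc x, hx.eq, mul_assoc]

lemma twist_mul_left {x y u : P} (hx : x * u = z * (u * x))
    (hy : Commute y u) : x * y * u = z * (u * (x * y)) := by
  rw [mul_assoc, hy.eq, ← mul_assoc, hx, mul_assoc, mul_assoc]

/-- Squaring is a quadratic map whose polar form is the commutator. Every later exchange of pairs
rests on this identity. -/
lemma sq_mul_of_twist (hP : CommutatorsIn P z) {x y : P} (h : x * y = z * (y * x)) :
    x * y * (x * y) = z * (x * x * (y * y)) := by
  rw [show x * y * (x * y) = x * (y * x) * y by group, hP.twist_symm h, ← mul_assoc x,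
    hP.comm_z]
  group

/-- Any element becomes central to the pair `u`, `v` after multiplication by an element of
`⟨u, v⟩`. -/
lemma exists_mul_commute (hP : CommutatorsIn P z) {u v : P} (huv : u * v ≠ v * u) (g : P) :
    ∃ w ∈ Subgroup.closure {u, v}, Commute (g * w) u ∧ Commute (g * w) v := by
  have h1 := hP.twist_of_ne huv
  have h2 := hP.twist_symm h1
  have hu : u ∈ Subgroup.closure {u, v} := Subgroup.subset_closure (by simp)
  have hv : v ∈ Subgroup.closure {u, v} := Subgroup.subset_closure (by simp)
  -- Orthogonal projection off the plane: `u` corrects a twist with `v`, `v` one with `u`, and `u *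
  -- v` corrects both.
  rcases hP.mul_eq g u with hgu | hgu <;> rcases hP.mul_eq g v with hgv | hgv
  · exact ⟨1, one_mem _, by rwa [mul_one], by rwa [mul_one]⟩
  · exact ⟨u, hu, Commute.mul_left hgu (.refl u), hP.commute_mul hgv h1⟩
  · exact ⟨v, hv, hP.commute_mul hgu h2, Commute.mul_left hgv (.refl v)⟩
  · refine ⟨u * v, mul_mem hu hv, ?_, ?_⟩
    · exact hP.commute_mul hgu (hP.twist_mul_right (.refl u) h2)
    · exact hP.commute_mul hgv (twist_mul_left h1 (.refl v))

end CommutatorsIn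

/-! ### Splitting off non-commuting pairs -/

/-- The subgroup `K` contains the center of `P`, which is also the center of `K`. -/
structure IsNondegenerate {P : Type*} [Group P] (K : Subgroup P) : Prop where
  center_le : Subgroup.center P ≤ K
  mem_center : ∀ x ∈ K, (∀ y ∈ K, x * y = y * x) → x ∈ Subgroup.center P

/-- The elements of `K` commuting with `u` and `v`. -/
def residual {P : Type*} [Group P] (K : Subgroup P) (u v : P) : Subgroup P :=
  K ⊓ (Subgroup.centralizer {u} ⊓ Subgroup.centralizer {v})

lemma mem_residual {P : Type*} [Group P] {K : Subgroup P} {u v x : P} :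
    x ∈ residual K u v ↔ x ∈ K ∧ Commute x u ∧ Commute x v := by
  simp [residual, Subgroup.mem_inf, Subgroup.mem_centralizer_singleton_iff, Commute,
    SemiconjBy]

lemma commute_of_mem_closure_pair {P : Type*} [Group P] {u v x y : P}
    (hx : x ∈ Subgroup.closure {u, v}) (hu : Commute y u) (hv : Commute y v) : Commute x y := by
  have : Subgroup.closure {u, v} ≤ Subgroup.centralizer {y} := by
    rw [Subgroup.closure_le]
    rintro w (rfl | rfl)
    · exact Subgroup.mem_centralizer_singleton_iff.2 hu.eq.symm
    · exact Subgroup.mem_centralizer_singleton_iff.2 hv.eq.symm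
  exact Subgroup.mem_centralizer_singleton_iff.1 (this hx)

lemma closure_pair_le {P : Type*} [Group P] {K : Subgroup P} {u v : P} (hu : u ∈ K)
    (hv : v ∈ K) : Subgroup.closure {u, v} ≤ K := by
  rw [Subgroup.closure_le]
  rintro w (rfl | rfl) <;> assumption

lemma closure_pair_sup_residual {P : Type*} [Group P] {z : P} (hP : CommutatorsIn P z)
    {K : Subgroup P} {u v : P} (hu : u ∈ K) (hv : v ∈ K) (huv : u * v ≠ v * u) :
    Subgroup.closure {u, v} ⊔ residual K u v = K := by
  refine le_antisymm (sup_le (closure_pair_le hu hv) inf_le_left) fun g hg => ?_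
  obtain ⟨w, hw, h1, h2⟩ := hP.exists_mul_commute huv g
  rw [show g = g * w * w⁻¹ by group]
  refine mul_mem ((le_sup_right : residual K u v ≤ _) ?_)
    ((le_sup_left : Subgroup.closure {u, v} ≤ _) (inv_mem hw))
  exact mem_residual.2 ⟨mul_mem hg (closure_pair_le hu hv hw), h1, h2⟩

/-- An element orthogonal to the residual is, lying in it, also orthogonal to `u` and `v`, hence to
all of `K`. -/
lemma isNondegenerate_residual {P : Type*} [Group P] {z : P} (hP : CommutatorsIn P z)
    {K : Subgroup P} (hK : IsNondegenerate K) {u v : P} (hu : u ∈ K) (hv : v ∈ K)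
    (huv : u * v ≠ v * u) : IsNondegenerate (residual K u v) where
  center_le x hx := mem_residual.2 ⟨hK.center_le hx, (Subgroup.mem_center_iff.1 hx u).symm,
    (Subgroup.mem_center_iff.1 hx v).symm⟩
  mem_center x hx h := by
    obtain ⟨hxK, hxu, hxv⟩ := mem_residual.1 hx
    refine hK.mem_center x hxK fun y hy => ?_
    have : K ≤ Subgroup.centralizer {x} := by
      rw [← closure_pair_sup_residual hP hu hv huv]
      refine sup_le (fun w hw => ?_) (fun w hw => ?_)
      · exact Subgroup.mem_centralizer_singleton_iff.2 (commute_of_mem_closure_pair hw hxu hxv)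
      · exact Subgroup.mem_centralizer_singleton_iff.2 (h w hw).symm
    exact (Subgroup.mem_centralizer_singleton_iff.1 (this hy)).symm

lemma IsNondegenerate.exists_ne {P : Type*} [Group P] {K : Subgroup P} (hK : IsNondegenerate K)
    (h : K ≠ Subgroup.center P) : ∃ u ∈ K, ∃ v ∈ K, u * v ≠ v * u := by
  by_contra! h'
  exact h (le_antisymm (fun x hx => hK.mem_center x hx (h' x hx)) hK.center_le)

/-- Greedy decomposition: dihedral pairs are split off until at most one special pair is left. -/
theorem IsNondegenerate.exists_decomposition {P : Type*} [Group P] [Finite P] {z : P}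
    (hP : CommutatorsIn P z) (S : P → P → Prop)
    (hS : ∀ x y : P, x * y ≠ y * x → ∀ K : Subgroup P, Subgroup.center P ≤ K → x ∈ K → y ∈ K →
      ∃ u ∈ K, ∃ v ∈ K, u * v ≠ v * u ∧ ((u * u = 1 ∧ v * v = 1) ∨ S u v))
    (hSS : ∀ x y x' y' : P, S x y → S x' y' → x * y ≠ y * x → x' * y' ≠ y' * x' →
      Commute x' x → Commute x' y → Commute y' x → Commute y' y →
      ∀ K : Subgroup P, Subgroup.center P ≤ K → x ∈ K → y ∈ K → x' ∈ K → y' ∈ K →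
      ∃ u ∈ K, ∃ v ∈ K, u * v ≠ v * u ∧ u * u = 1 ∧ v * v = 1)
    (hSZ : ∀ x y : P, S x y → Subgroup.center P ≤ Subgroup.closure {x, y})
    (n : ℕ) (K : Subgroup P) (hn : Nat.card K ≤ n) (hK : IsNondegenerate K) :
    ∃ (ε : ℕ) (D : Subgroup P), HasCentralDecomposition D (List.replicate ε (Q 2 1 1)) ∧
      ((Subgroup.center P ⊔ D = K ∧ (2 ≤ ε → HasCommutingNonabelianPairs P)) ∨
      ((∃ x y, S x y ∧ x * y ≠ y * x ∧ (∀ g ∈ D, Commute g x ∧ Commute g y) ∧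
        Subgroup.closure {x, y} ⊔ D = K) ∧ (1 ≤ ε → HasCommutingNonabelianPairs P))) := by
  -- Induction on a bound for the order of `K`. `hS` normalises a pair to two involutions or to a
  -- special pair, `hSS` extracts involutions from two orthogonal special pairs, and `hSZ` lets a
  -- special pair absorb the center.
  induction n generalizing K with
  | zero => exact absurd hn (by have := Nat.card_pos (α := K); omega)
  | succ n ih =>
    by_cases hKZ : K = Subgroup.center P
    · exact ⟨0, ⊥, hasCentralDecomposition_nil, .inl ⟨by simp [hKZ], by omega⟩⟩
    by_cases hD : ∃ u ∈ K, ∃ v ∈ K, u * v ≠ v * u ∧ u * u = 1 ∧ v * v = 1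
    · obtain ⟨u, hu, v, hv, huv, hu2, hv2⟩ := hD
      have hres := isNondegenerate_residual hP hK hu hv huv
      have hsup := closure_pair_sup_residual hP hu hv huv
      have hiso := closure_equiv_dihedral hP.mem_center hP.mul_self hu2 hv2
        (hP.twist_of_ne huv) huv
      by_cases hKZ' : residual K u v = Subgroup.center P
      · refine ⟨1, Subgroup.closure {u, v} ⊔ ⊥, hasCentralDecomposition_nil.cons hiso ?_,
          .inl ⟨?_, by omega⟩⟩
        · rintro x - y rfl; simp
        · rw [sup_bot_eq, ← hKZ', sup_comm, hsup]
      · have hlt : residual K u v < K := by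
          refine lt_of_le_of_ne inf_le_left fun h => huv ?_
          rw [← h] at hu
          exact (mem_residual.1 hu).2.2
        -- A noncentral residual supplies a second plane orthogonal to `⟨u, v⟩`.
        have hpairs : HasCommutingNonabelianPairs P := by
          obtain ⟨x, hx, y, hy, hxy⟩ := hres.exists_ne hKZ'
          have hx' := (mem_residual.1 hx).2
          have hy' := (mem_residual.1 hy).2
          exact ⟨x, y, u, v, hxy, huv, hx'.1, hx'.2, hy'.1, hy'.2⟩
        have hcard : Nat.card (residual K u v) < Nat.card K :=
          Set.Finite.card_lt_card (Set.toFinite _) hlt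
        obtain ⟨ε, D, hdec, h⟩ := ih _ (by omega) hres
        have hDle : D ≤ residual K u v := by
          rcases h with ⟨h, -⟩ | ⟨⟨_, _, -, -, -, h⟩, -⟩ <;> exact h ▸ le_sup_right
        refine ⟨ε + 1, Subgroup.closure {u, v} ⊔ D, hdec.cons hiso fun x hx y hy => ?_, ?_⟩
        · exact commute_of_mem_closure_pair hx (mem_residual.1 (hDle hy)).2.1
            (mem_residual.1 (hDle hy)).2.2
        · rcases h with ⟨h, -⟩ | ⟨⟨x, y, hSxy, hxy, hc, h⟩, -⟩
          · refine .inl ⟨?_, fun _ => hpairs⟩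
            rw [sup_left_comm, h, hsup]
          · refine .inr ⟨⟨x, y, hSxy, hxy, ?_, ?_⟩, fun _ => hpairs⟩
            · have hle : Subgroup.closure {u, v} ⊔ D ≤
                  Subgroup.centralizer {x} ⊓ Subgroup.centralizer {y} := by
                have hmem : ∀ w ∈ ({x, y} : Set P), w ∈ residual K u v := fun w hw =>
                  h ▸ (le_sup_left : Subgroup.closure {x, y} ≤ _) (Subgroup.subset_closure hw)
                have hx := (mem_residual.1 (hmem x (by simp))).2
                have hy := (mem_residual.1 (hmem y (by simp))).2
                refine sup_le (fun g hg => ⟨?_, ?_⟩) (fun g hg => ⟨?_, ?_⟩)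
                · exact Subgroup.mem_centralizer_singleton_iff.2
                    (commute_of_mem_closure_pair hg hx.1 hx.2)
                · exact Subgroup.mem_centralizer_singleton_iff.2
                    (commute_of_mem_closure_pair hg hy.1 hy.2)
                · exact Subgroup.mem_centralizer_singleton_iff.2 (hc g hg).1
                · exact Subgroup.mem_centralizer_singleton_iff.2 (hc g hg).2
              exact fun g hg => ⟨Subgroup.mem_centralizer_singleton_iff.1 (hle hg).1,
                Subgroup.mem_centralizer_singleton_iff.1 (hle hg).2⟩
            · rw [sup_left_comm, h, hsup]
    · obtain ⟨x₀, hx₀, y₀, hy₀, hne₀⟩ := hK.exists_ne hKZ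
      obtain ⟨x, hx, y, hy, hxy, hxy'⟩ := hS x₀ y₀ hne₀ K hK.center_le hx₀ hy₀
      have hSxy : S x y := hxy'.resolve_left fun h => hD ⟨x, hx, y, hy, hxy, h⟩
      have hres := isNondegenerate_residual hP hK hx hy hxy
      have hsup := closure_pair_sup_residual hP hx hy hxy
      -- With no involution pair left in `K`, a second plane would be special as well, and `hSS`
      -- would then produce an involution pair.
      have hKZ' : residual K x y = Subgroup.center P := by
        by_contra hKZ'
        obtain ⟨x₁, hx₁, y₁, hy₁, hne₁⟩ := hres.exists_ne hKZ'
        obtain ⟨x', hx', y', hy', hxy₁, hor⟩ := hS x₁ y₁ hne₁ _ hres.center_le hx₁ hy₁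
        obtain ⟨hx'K, hx'x, hx'y⟩ := mem_residual.1 hx'
        obtain ⟨hy'K, hy'x, hy'y⟩ := mem_residual.1 hy'
        rcases hor with hor | hor
        · exact hD ⟨x', hx'K, y', hy'K, hxy₁, hor⟩
        · exact hD (hSS x y x' y' hSxy hor hxy hxy₁ hx'x hx'y hy'x hy'y K hK.center_le hx hy
            hx'K hy'K)
      refine ⟨0, ⊥, hasCentralDecomposition_nil, .inr ⟨⟨x, y, hSxy, hxy, ?_, ?_⟩, by omega⟩⟩
      · rintro g rfl; simp
      · rw [sup_bot_eq, ← hsup, hKZ', left_eq_sup]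
        exact hSZ x y hSxy

end CentGroups

/-! ### 2-groups with cyclic center and central squares. -/

namespace CentGroups

/-- A commutator is a product of squares: `[x,y] = (yx)⁻² x² y²`. -/
lemma comm_mem_center {P : Type*} [Group P] (hsq : ∀ x : P, x * x ∈ Subgroup.center P) (x y : P) :
    comm x y ∈ Subgroup.center P := by
  have h : comm x y = (y * x * (y * x))⁻¹ * (x * x) * (y * y) := by
    calc comm x y = x⁻¹ * y⁻¹ * x⁻¹ * (x * x * y⁻¹) * (y * y) := by simp only [comm]; group
      _ = _ := by rw [← Subgroup.mem_center_iff.1 (hsq x) y⁻¹]; group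
  rw [h]
  exact mul_mem (mul_mem (inv_mem (hsq _)) (hsq _)) (hsq _)

/-- Moving `x²` past `y` costs `[x,y]²`, yet `x²` is central. -/
lemma comm_mul_self {P : Type*} [Group P] (hsq : ∀ x : P, x * x ∈ Subgroup.center P) (x y : P) :
    comm x y * comm x y = 1 := by
  have hc := Subgroup.mem_center_iff.1 (comm_mem_center hsq x y)
  have h := Subgroup.mem_center_iff.1 (hsq x) y
  have h1 : x * x * y = y * (x * x) * (comm x y * comm x y) := by
    rw [mul_assoc, mul_eq_mul_comm x y, ← mul_assoc, ← mul_assoc, mul_eq_mul_comm x y,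
      mul_assoc (y * x), ← hc x]
    group
  rw [← h] at h1
  simpa using h1

lemma eq_one_or_eq_of_mul_self {P : Type*} [Group P] {c t : P} {m : ℕ}
    (hc : orderOf c = 2 ^ (m + 1)) (ht : t ∈ Subgroup.zpowers c) (h : t * t = 1) :
    t = 1 ∨ t = c ^ 2 ^ m := by
  obtain ⟨k, rfl⟩ := Subgroup.mem_zpowers_iff.1 ht
  rw [← zpow_add, ← orderOf_dvd_iff_zpow_eq_one, hc, ← two_mul, pow_succ'] at h
  push_cast at h
  obtain ⟨l, rfl⟩ := (mul_dvd_mul_iff_left (two_ne_zero' ℤ)).1 h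
  have hpow : c ^ 2 ^ (m + 1) = 1 := by rw [← hc, pow_orderOf_eq_one]
  rcases Int.even_or_odd' l with ⟨j, rfl | rfl⟩
  · left
    rw [show (2 : ℤ) ^ m * (2 * j) = ((2 ^ (m + 1) : ℕ) : ℤ) * j by push_cast; ring, zpow_mul,
      zpow_natCast, hpow, one_zpow]
  · right
    rw [show (2 : ℤ) ^ m * (2 * j + 1) = ((2 ^ (m + 1) : ℕ) : ℤ) * j + ((2 ^ m : ℕ) : ℤ) by
      push_cast; ring, zpow_add, zpow_mul, zpow_natCast, hpow, one_zpow, one_mul, zpow_natCast]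

/-- In the central subgroup generated by `c`, every element is a square or `c` times a square. -/
lemma exists_sq_or {P : Type*} [Group P] {c t : P} (ht : t ∈ Subgroup.zpowers c) :
    ∃ d ∈ Subgroup.zpowers c, t = d * d ∨ t = c * (d * d) := by
  obtain ⟨k, rfl⟩ := Subgroup.mem_zpowers_iff.1 ht
  rcases Int.even_or_odd' k with ⟨j, rfl | rfl⟩
  · exact ⟨c ^ j, ⟨j, rfl⟩, .inl (by rw [← zpow_add, two_mul])⟩
  · exact ⟨c ^ j, ⟨j, rfl⟩, .inr (by rw [← zpow_add, ← zpow_one_add]; ring_nf)⟩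

/-- The element `c d²` is an odd power of `c`, and odd exponents are invertible modulo `2 ^ m`. -/
lemma zpowers_mul_sq {P : Type*} [Group P] {c d : P} {m : ℕ} (hc : orderOf c = 2 ^ m)
    (hd : d ∈ Subgroup.zpowers c) :
    Subgroup.zpowers (c * (d * d)) = Subgroup.zpowers c := by
  obtain ⟨k, rfl⟩ := Subgroup.mem_zpowers_iff.1 hd
  have h : c * (c ^ k * c ^ k) = c ^ (2 * k + 1) := by
    rw [← zpow_add, ← zpow_one_add]; ring_nf
  rw [h]
  refine le_antisymm (Subgroup.zpowers_le.2 ⟨_, rfl⟩) (Subgroup.zpowers_le.2 ?_)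
  have hcop : IsCoprime (2 * k + 1) ((2 : ℤ) ^ m) :=
    IsCoprime.pow_right ⟨1, -k, by ring⟩
  obtain ⟨p, q, hpq⟩ := hcop
  refine ⟨p, ?_⟩
  have hpow : c ^ 2 ^ m = 1 := by rw [← hc, pow_orderOf_eq_one]
  show (c ^ (2 * k + 1)) ^ p = c
  have : c ^ (q * 2 ^ m) = 1 := by
    rw [mul_comm, zpow_mul, show (2 : ℤ) ^ m = ((2 ^ m : ℕ) : ℤ) by push_cast; rfl, zpow_natCast,
      hpow, one_zpow]
  calc (c ^ (2 * k + 1)) ^ p = c ^ (p * (2 * k + 1)) * c ^ (q * 2 ^ m) := by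
        rw [this, mul_one, ← zpow_mul, mul_comm]
    _ = c := by rw [← zpow_add, hpq, zpow_one]

/-- Data extracted from a `2`-group with cyclic center and central squares. -/
lemma exists_generator {P : Type*} [Group P] [Finite P] (hp : IsPGroup 2 P)
    (hZ : IsCyclic (Subgroup.center P)) (hsq : ∀ x : P, x * x ∈ Subgroup.center P)
    (hna : NonAbelian P) :
    ∃ (c : P) (m : ℕ), Subgroup.center P = Subgroup.zpowers c ∧ orderOf c = 2 ^ (m + 1) ∧
      c ^ 2 ^ m ≠ 1 ∧ CommutatorsIn P (c ^ 2 ^ m) := by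
  obtain ⟨⟨c, hc⟩, hgen⟩ := hZ.exists_generator
  have hcZ : Subgroup.center P = Subgroup.zpowers c := by
    refine le_antisymm (fun x hx => ?_) (Subgroup.zpowers_le.2 hc)
    obtain ⟨k, hk⟩ := Subgroup.mem_zpowers_iff.1 (hgen ⟨x, hx⟩)
    exact ⟨k, by simpa using congrArg Subtype.val hk⟩
  obtain ⟨m, hm⟩ := IsPGroup.iff_orderOf.1 hp c
  obtain ⟨x, y, hxy⟩ := hna
  have hmem := comm_mem_center hsq x y
  have hm0 : m ≠ 0 := by
    rintro rfl
    rw [pow_zero, orderOf_eq_one_iff] at hm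
    rw [hcZ, hm, Subgroup.zpowers_one_eq_bot, Subgroup.mem_bot, comm_eq_one_iff] at hmem
    exact hxy hmem
  obtain ⟨m, rfl⟩ := Nat.exists_eq_succ_of_ne_zero hm0
  refine ⟨c, m, hcZ, hm, ?_, ?_⟩
  · rw [Ne, ← orderOf_dvd_iff_pow_eq_one, hm]
    exact fun h => absurd (Nat.le_of_dvd (by positivity) h)
      (not_le.2 (Nat.pow_lt_pow_right one_lt_two (Nat.lt_succ_self m)))
  · refine ⟨pow_mem hc _, ?_, fun u v => ?_⟩
    · rw [← pow_add, ← two_mul, ← pow_succ', ← Nat.succ_eq_add_one, ← hm, pow_orderOf_eq_one]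
    · rcases eq_one_or_eq_of_mul_self hm (hcZ ▸ comm_mem_center hsq u v) (comm_mul_self hsq u v)
        with h | h
      · exact .inl (comm_eq_one_iff.1 h)
      · right
        rw [mul_eq_mul_comm u v, h, Subgroup.mem_center_iff.1 (pow_mem hc _)]

/-- Turns an element whose square has a central square root into one squaring to one, without
changing its coset of the center. -/
lemma mul_inv_mul_self {P : Type*} [Group P] {x d : P} (hd : d ∈ Subgroup.center P)
    (h : x * x = d * d) : x * d⁻¹ * (x * d⁻¹) = 1 := by
  rw [mul_assoc, ← mul_assoc d⁻¹, ← Subgroup.mem_center_iff.1 (inv_mem hd) x,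
    show x * (x * d⁻¹ * d⁻¹) = x * x * (d⁻¹ * d⁻¹) by group, h]
  group

lemma isNondegenerate_top {P : Type*} [Group P] : IsNondegenerate (⊤ : Subgroup P) where
  center_le := le_top
  mem_center _ _ h := Subgroup.mem_center_iff.2 fun g => (h g (Subgroup.mem_top g)).symm

/-- Extraspecial case. -/
theorem decomposition_of_card_center_eq_two {P : Type*} [Group P] [Finite P] {z : P}
    (hna : NonAbelian P) (hz : z ≠ 1) (hP : CommutatorsIn P z)
    (hZ : Subgroup.center P = Subgroup.zpowers z) (hsq : ∀ x : P, x * x ∈ Subgroup.center P) :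
    (∃ ε : ℕ, 1 ≤ ε ∧ IsCentralProductOf P (List.replicate ε (Q 2 1 1)) ∧
      (2 ≤ ε → HasCommutingNonabelianPairs P)) ∨
    (∃ ε : ℕ, IsCentralProductOf P (R 1 :: List.replicate ε (Q 2 1 1)) ∧
      (1 ≤ ε → HasCommutingNonabelianPairs P)) := by
  have hsq' : ∀ x : P, x * x = 1 ∨ x * x = z := fun x => by
    have := hsq x
    rw [hZ] at this
    have hord : orderOf z = 2 ^ (0 + 1) := by
      simpa using orderOf_eq_prime (p := 2) (by rw [pow_two, hP.mul_self]) hz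
    refine (eq_one_or_eq_of_mul_self hord this ?_).imp_right fun h => by simpa using h
    obtain ⟨k, hk⟩ := Subgroup.mem_zpowers_iff.1 this
    rw [← hk, ← (Commute.refl z).mul_zpow, hP.mul_self, one_zpow]
  obtain ⟨ε, D, hdec, h⟩ := isNondegenerate_top.exists_decomposition hP
    -- The special pairs are the quaternion ones.
    (fun x y => x * x = z ∧ y * y = z)
    (by
      intro x y hne K _ hx hy
      have ht := hP.twist_of_ne hne
      rcases hsq' x with h1 | h1 <;> rcases hsq' y with h2 | h2
      · exact ⟨x, hx, y, hy, hne, .inl ⟨h1, h2⟩⟩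
      · refine ⟨x, hx, x * y, mul_mem hx hy, ?_, .inl ⟨h1, ?_⟩⟩
        · rw [mul_assoc]; exact fun h => hne (mul_left_cancel h)
        · rw [hP.sq_mul_of_twist ht, h1, h2, one_mul, hP.mul_self]
      · refine ⟨x * y, mul_mem hx hy, y, hy, ?_, .inl ⟨?_, h2⟩⟩
        · rw [← mul_assoc y]; exact fun h => hne (mul_right_cancel h)
        · rw [hP.sq_mul_of_twist ht, h1, h2, mul_one, hP.mul_self]
      · exact ⟨x, hx, y, hy, hne, .inr ⟨h1, h2⟩⟩)
    (by
      rintro x y x' y' ⟨hx, hy⟩ ⟨hx', hy'⟩ hne hne' cxx cxy cyx cyy K - hxK hyK hxK' hyK'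
      -- The exchange `Q₈ ∘ Q₈ = D₈ ∘ D₈`: `x'x` squares to `z² = 1`, still twists with `y`, and so
      -- `(x'xy)² = z · 1 · z = 1`.
      have hu : x' * x * (x' * x) = 1 := by
        rw [cxx.eq, show x * x' * (x * x') = x * (x' * x) * x' by group, cxx.eq,
          show x * (x * x') * x' = x * x * (x' * x') by group, hx, hx', hP.mul_self]
      have ht : x' * x * y = z * (y * (x' * x)) :=
        hP.twist_mul_right cxy (hP.twist_of_ne hne)
      have hne2 := CommutatorsIn.ne_of_twist hz ht
      refine ⟨x' * x, mul_mem hxK' hxK, x' * x * y, mul_mem (mul_mem hxK' hxK) hyK, ?_, hu, ?_⟩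
      · rw [mul_assoc (x' * x) y]; exact fun h => hne2 (mul_left_cancel h)
      · rw [hP.sq_mul_of_twist ht, hu, hy, one_mul, hP.mul_self])
    (by
      rintro x y ⟨hx, -⟩
      rw [hZ, Subgroup.zpowers_le, ← hx]
      exact mul_mem (Subgroup.subset_closure (by simp)) (Subgroup.subset_closure (by simp)))
    (Nat.card (⊤ : Subgroup P)) ⊤ le_rfl
  rcases h with ⟨h, hb⟩ | ⟨⟨x, y, ⟨hx, hy⟩, hxy, hc, h⟩, hb⟩
  · left
    obtain ⟨x, y, hxy⟩ := hna
    -- If `z ∉ D`, then `D` has no nontrivial commutator, so it is central because `P = Z(P) D`, and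
    -- `P` would be abelian.
    have hD : D = ⊤ := by
      rw [← h, eq_comm, sup_eq_right, hZ, Subgroup.zpowers_le]
      by_contra hzD
      have hDc : D ≤ Subgroup.center P := fun g hg => by
        refine Subgroup.mem_center_iff.2 fun k => ?_
        have hk : k ∈ Subgroup.center P ⊔ D := h ▸ Subgroup.mem_top k
        obtain ⟨s, hs, d, hd, rfl⟩ := Subgroup.mem_sup_of_normal_left.1 hk
        have : d * g = g * d := by
          by_contra hne
          refine hzD ?_
          rw [← comm_eq_of_mul_eq hP.mem_center (hP.twist_of_ne hne)]
          exact mul_mem (mul_mem (mul_mem (inv_mem hd) (inv_mem hg)) hd) hg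
        rw [mul_assoc, this, ← mul_assoc, ← Subgroup.mem_center_iff.1 hs g, mul_assoc]
      rw [sup_eq_left.2 hDc] at h
      exact hxy ((Subgroup.mem_center_iff.1 (h ▸ Subgroup.mem_top y) x))
    subst hD
    refine ⟨ε, ?_, hdec, hb⟩
    rw [Nat.one_le_iff_ne_zero]
    rintro rfl
    obtain ⟨H, -, -, hH⟩ := hdec
    have : IsEmpty (Fin (List.replicate 0 (Q 2 1 1)).length) := Fin.isEmpty'
    rw [iSup_of_empty] at hH
    have hx : x ∈ (⊥ : Subgroup P) := hH ▸ Subgroup.mem_top x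
    rw [Subgroup.mem_bot] at hx
    exact hxy (by simp [hx])
  · right
    refine ⟨ε, ?_, hb⟩
    have := hdec.cons (closure_equiv_quaternion hP.mem_center hP.mul_self hx hy
      (hP.twist_of_ne hxy) hxy) fun u hu g hg => commute_of_mem_closure_pair hu (hc g hg).1 (hc g hg).2
    rw [h] at this
    exact this

/-- The case of a center of order at least four. -/
theorem decomposition_of_four_le_card_center {P : Type*} [Group P] [Finite P] {c : P} {m : ℕ}
    (hna : NonAbelian P) (hord : orderOf c = 2 ^ (m + 2)) (hz : c ^ 2 ^ (m + 1) ≠ 1)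
    (hP : CommutatorsIn P (c ^ 2 ^ (m + 1)))
    (hZ : Subgroup.center P = Subgroup.zpowers c) (hsq : ∀ x : P, x * x ∈ Subgroup.center P) :
    (∃ n ε : ℕ, 1 < n ∧ 1 ≤ ε ∧ IsCentralProductOf P (Q 2 n 0 :: List.replicate ε (Q 2 1 1)) ∧
      (2 ≤ ε → HasCommutingNonabelianPairs P)) ∨
    (∃ n ε : ℕ, 2 < n ∧ IsCentralProductOf P (Q 2 n 1 :: List.replicate ε (Q 2 1 1)) ∧
      (1 ≤ ε → HasCommutingNonabelianPairs P)) := by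
  set z := c ^ 2 ^ (m + 1) with hzdef
  -- This is where order at least four matters: `z` has a central square root, so it can be absorbed
  -- into corrections by central elements.
  have hw : ∃ w ∈ Subgroup.center P, z = w * w :=
    ⟨c ^ 2 ^ m, hZ ▸ Subgroup.npow_mem_zpowers _ _, by rw [hzdef, ← pow_add, ← two_mul, pow_succ']⟩
  obtain ⟨w, hwZ, hzw⟩ := hw
  have hcZ : c ∈ Subgroup.center P := hZ ▸ Subgroup.mem_zpowers c
  have hsq' : ∀ x : P, ∃ d ∈ Subgroup.center P, x * x = d * d ∨ x * x = c * (d * d) := fun x => by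
    have := hsq x
    rw [hZ] at this ⊢
    exact exists_sq_or this
  have hcm : ∀ {d : P}, d ∈ Subgroup.center P → ∀ g : P, Commute g d := fun hd g =>
    Subgroup.mem_center_iff.1 hd g
  have hmulne : ∀ {x y d e : P}, d ∈ Subgroup.center P → e ∈ Subgroup.center P →
      x * y ≠ y * x → x * d⁻¹ * (y * e⁻¹) ≠ y * e⁻¹ * (x * d⁻¹) := by
    intro x y d e hd he hne h
    refine hne ?_
    have hd' := inv_mem hd
    have he' := inv_mem he
    have h1 : Commute (x * d⁻¹) (y * e⁻¹) := h
    have h2 : Commute x (y * e⁻¹) := by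
      simpa using h1.mul_left (hcm hd (y * e⁻¹)).symm
    simpa using (h2.mul_right (hcm he x)).eq
  obtain ⟨ε, D, hdec, h⟩ := isNondegenerate_top.exists_decomposition hP
    -- The special pairs generate modular groups: `x²` generates the center and `y` is an
    -- involution.
    (fun x y => (∃ d ∈ Subgroup.center P, x * x = c * (d * d)) ∧ y * y = 1)
    (by
      intro x y hne K hK hx hy
      have ht := hP.twist_of_ne hne
      obtain ⟨d, hd, h1⟩ := hsq' x
      obtain ⟨e, he, h2⟩ := hsq' y
      have hxd : x * d⁻¹ ∈ K := mul_mem hx (inv_mem (hK hd))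
      have hye : y * e⁻¹ ∈ K := mul_mem hy (inv_mem (hK he))
      rcases h1 with h1 | h1 <;> rcases h2 with h2 | h2
      · exact ⟨_, hxd, _, hye, hmulne hd he hne,
          .inl ⟨mul_inv_mul_self hd h1, mul_inv_mul_self he h2⟩⟩
      · exact ⟨y, hy, _, hxd, by simpa using hmulne (one_mem _) hd hne.symm,
          .inr ⟨⟨e, he, h2⟩, mul_inv_mul_self hd h1⟩⟩
      · exact ⟨x, hx, _, hye, by simpa using hmulne (one_mem _) he hne,
          .inr ⟨⟨d, hd, h1⟩, mul_inv_mul_self he h2⟩⟩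
      -- The central square root of `(xy)² = z · c d² · c e²`.
      · have hf : w * c * d * e ∈ Subgroup.center P :=
          mul_mem (mul_mem (mul_mem hwZ hcZ) hd) he
        refine ⟨x, hx, x * y * (w * c * d * e)⁻¹, mul_mem (mul_mem hx hy) (inv_mem (hK hf)), ?_,
          .inr ⟨⟨d, hd, h1⟩, mul_inv_mul_self hf ?_⟩⟩
        · have : x * (x * y) ≠ x * y * x := by
            rw [mul_assoc x y]; exact fun h => hne (mul_left_cancel h)
          simpa using hmulne (one_mem _) hf this
        · rw [hP.sq_mul_of_twist ht, h1, h2, hzw]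
          have key : ∀ w c d e : Subgroup.center P,
              w * w * (c * (d * d) * (c * (e * e))) = w * c * d * e * (w * c * d * e) := by
            intro w c d e
            ac_rfl
          simpa using congrArg Subtype.val (key ⟨w, hwZ⟩ ⟨c, hcZ⟩ ⟨d, hd⟩ ⟨e, he⟩))
    (by
      rintro x y x' y' ⟨⟨d, hd, hx⟩, hy⟩ ⟨⟨e, he, hx'⟩, hy'⟩ hne hne' cxx cxy cyx cyy K hK hxK hyK
        hxK' hyK'
      -- Since `x` and `x'` commute, `(x'x)² = c d² · c e²` has this root and no factor `z` appears.
      have hf : c * d * e ∈ Subgroup.center P := mul_mem (mul_mem hcZ hd) he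
      refine ⟨x' * x * (c * d * e)⁻¹, mul_mem (mul_mem hxK' hxK) (inv_mem (hK hf)), y, hyK, ?_,
        mul_inv_mul_self hf ?_, hy⟩
      · have := CommutatorsIn.ne_of_twist hz (hP.twist_mul_right cxy (hP.twist_of_ne hne))
        simpa using hmulne hf (one_mem _) this
      · rw [cxx.eq, show x * x' * (x * x') = x * (x' * x) * x' by group, cxx.eq,
          show x * (x * x') * x' = x * x * (x' * x') by group, hx, hx']
        have key : ∀ c d e : Subgroup.center P,
            c * (d * d) * (c * (e * e)) = c * d * e * (c * d * e) := by
          intro c d e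
          ac_rfl
        simpa using congrArg Subtype.val (key ⟨c, hcZ⟩ ⟨d, hd⟩ ⟨e, he⟩))
    (by
      rintro x y ⟨⟨d, hd, hx⟩, -⟩
      rw [hZ, ← zpowers_mul_sq hord (hZ ▸ hd), Subgroup.zpowers_le, ← hx]
      exact mul_mem (Subgroup.subset_closure (by simp)) (Subgroup.subset_closure (by simp)))
    (Nat.card (⊤ : Subgroup P)) ⊤ le_rfl
  rcases h with ⟨h, hb⟩ | ⟨⟨x, y, ⟨⟨d, hd, hx⟩, hy⟩, hxy, hc, h⟩, hb⟩
  · left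
    obtain ⟨x, y, hxy⟩ := hna
    -- The factor `Q(m + 2, 0)` is the center itself, which the dihedral factors need not contain.
    refine ⟨m + 2, ε, by omega, ?_, ?_, hb⟩
    · rw [Nat.one_le_iff_ne_zero]
      rintro rfl
      obtain ⟨H, -, -, hH⟩ := hdec
      have : IsEmpty (Fin (List.replicate 0 (Q 2 1 1)).length) := Fin.isEmpty'
      rw [iSup_of_empty] at hH
      rw [← hH, sup_bot_eq] at h
      exact hxy ((Subgroup.mem_center_iff.1 (h ▸ Subgroup.mem_top y) x))
    · have := hdec.cons (zpowers_equiv_cyclic hord) fun u hu g _ =>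
        (Subgroup.mem_center_iff.1 (hZ ▸ hu) g).symm
      rw [← hZ, h] at this
      exact this
  · right
    -- The exponent exceeds that of the center by one because `x²`, not `x`, generates the center.
    refine ⟨m + 2 + 1, ε, by omega, ?_, hb⟩
    have hordx : orderOf (x * x) = 2 ^ (m + 2) := by
      rw [← hord, hx, ← Nat.card_zpowers, ← Nat.card_zpowers, zpowers_mul_sq hord (hZ ▸ hd)]
    have hxz : x ^ 2 ^ (m + 2) = z := by
      rw [hZ] at hd
      obtain ⟨k, rfl⟩ := Subgroup.mem_zpowers_iff.1 hd
      rw [pow_succ', pow_mul, pow_two, hx, ← zpow_add, (Commute.self_zpow c _).mul_pow, ← hzdef,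
        ← zpow_natCast, ← zpow_mul]
      have : c ^ ((k + k) * ((2 ^ (m + 1) : ℕ) : ℤ)) = 1 := by
        rw [← orderOf_dvd_iff_zpow_eq_one, hord]
        exact ⟨k, by push_cast; ring⟩
      rw [this, mul_one]
    have := hdec.cons (closure_equiv_modular (by omega) hP.mem_center hordx hxz hy
      (hP.twist_of_ne hxy) hxy) fun u hu g hg => commute_of_mem_closure_pair hu (hc g hg).1 (hc g hg).2
    rw [h] at this
    exact this

end CentGroups

/-! ### From the centralizer count to a 2-group. -/

namespace CentGroups

/-- Distinct centralizers of distinct cosets of the center force central squares. -/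
lemma mul_self_mem_center {G : Type*} [Group G] [Finite G]
    (hcent : Nat.card (Cent G) = Nat.card G / Nat.card (Subgroup.center G)) (x : G) :
    x * x ∈ Subgroup.center G := by
  have hmap : ∀ x y : G, QuotientGroup.leftRel (Subgroup.center G) x y →
      Subgroup.centralizer {x} = Subgroup.centralizer {y} := by
    intro x y h
    rw [QuotientGroup.leftRel_apply] at h
    ext g
    simp only [Subgroup.mem_centralizer_singleton_iff]
    have hg : Commute g (x⁻¹ * y) := Subgroup.mem_center_iff.1 h g
    constructor
    · intro h'
      have : Commute g (x * (x⁻¹ * y)) := Commute.mul_right h' hg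
      simpa using this.eq
    · intro h'
      have : Commute g (y * (x⁻¹ * y)⁻¹) := Commute.mul_right h' hg.inv_right
      simpa using this.eq
  let F : G ⧸ Subgroup.center G → Cent G := fun q =>
    Quotient.liftOn' q (fun x => ⟨Subgroup.centralizer {x}, x, rfl⟩)
      fun x y h => Subtype.ext (hmap x y h)
  have hsurj : Function.Surjective F := by
    rintro ⟨_, x, rfl⟩
    exact ⟨(x : G ⧸ Subgroup.center G), rfl⟩
  have hcard : Nat.card (G ⧸ Subgroup.center G) = Nat.card (Cent G) := by
    rw [hcent, Subgroup.card_eq_card_quotient_mul_card_subgroup (Subgroup.center G),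
      Nat.mul_div_cancel _ Nat.card_pos]
  have hinj : Function.Injective F := (hsurj.bijective_of_nat_card_le hcard.le).1
  -- Equal centralizers force equal cosets, and `x⁻¹Z = xZ` says that `x²` is central.
  have : ((x⁻¹ : G) : G ⧸ Subgroup.center G) = (x : G) := by
    refine hinj (Subtype.ext ?_)
    show Subgroup.centralizer {x⁻¹} = Subgroup.centralizer {x}
    ext g
    simp only [Subgroup.mem_centralizer_singleton_iff]
    exact Commute.inv_right_iff (a := g) (b := x)
  rw [QuotientGroup.eq] at this
  simpa using this

lemma mem_center_of_isCompl {G : Type*} [Group G] {A P : Subgroup G}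
    (hA : A ≤ Subgroup.center G) (hAP : A ⊔ P = ⊤) {p : P} (hp : p ∈ Subgroup.center P) :
    (p : G) ∈ Subgroup.center G := by
  have : (⊤ : Subgroup G) ≤ Subgroup.centralizer {(p : G)} := by
    rw [← hAP]
    refine sup_le (fun a ha => ?_) (fun q hq => ?_)
    · exact Subgroup.mem_centralizer_singleton_iff.2 (Subgroup.mem_center_iff.1 (hA ha) _).symm
    · exact Subgroup.mem_centralizer_singleton_iff.2
        (congrArg Subtype.val (Subgroup.mem_center_iff.1 hp ⟨q, hq⟩))
  exact Subgroup.mem_center_iff.2 fun g =>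
    Subgroup.mem_centralizer_singleton_iff.1 (this (Subgroup.mem_top g))

/-- A group with central squares and cyclic center is the product of a central cyclic subgroup of
odd order and a `2`-group. -/
lemma exists_odd_times_two_group {G : Type*} [Group G] [Finite G]
    (hsq : ∀ x : G, x * x ∈ Subgroup.center G) (hZ : IsCyclic (Subgroup.center G)) :
    ∃ A P : Subgroup G, IsOddCyclicTimesTwoGroup A P ∧ A ≤ Subgroup.center G := by
  obtain ⟨⟨c, hc⟩, hgen⟩ := hZ.exists_generator
  have hord : orderOf c ≠ 0 := (orderOf_pos c).ne'
  obtain ⟨m, t, ht, hmt⟩ := Nat.exists_eq_two_pow_mul_odd hord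
  set A : Subgroup G := Subgroup.zpowers (c ^ 2 ^ m) with hAdef
  have hAZ : A ≤ Subgroup.center G := Subgroup.zpowers_le.2 (pow_mem hc _)
  have hAcard : Nat.card A = t := by
    rw [hAdef, Nat.card_zpowers, orderOf_pow_of_dvd (by positivity) ⟨t, hmt⟩, hmt,
      Nat.mul_div_cancel_left _ (by positivity)]
  -- `A` is the odd part of the center; as `g²` is central, `(g²) ^ 2 ^ m` lies in `A`. So `G/A` is
  -- a 2-group.
  have hpow : ∀ g : G, ∃ k : ℕ, g ^ 2 ^ k ∈ A := fun g => by
    obtain ⟨k, hk⟩ := Subgroup.mem_zpowers_iff.1 (hgen ⟨g * g, hsq g⟩)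
    have hk : c ^ k = g * g := by simpa using congrArg Subtype.val hk
    refine ⟨m + 1, k, ?_⟩
    show (c ^ 2 ^ m) ^ k = _
    rw [pow_succ', pow_mul, pow_two, ← hk, ← zpow_natCast, ← zpow_natCast, ← zpow_mul, ← zpow_mul,
      mul_comm]
  have hAn : A.Normal := ⟨fun a ha g => by
    rw [Subgroup.mem_center_iff.1 (hAZ ha) g]; simpa using ha⟩
  have hq : IsPGroup 2 (G ⧸ A) := by
    intro q
    obtain ⟨g, rfl⟩ := QuotientGroup.mk_surjective q
    obtain ⟨k, hk⟩ := hpow g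
    exact ⟨k, by rw [← QuotientGroup.mk_pow, QuotientGroup.eq_one_iff]; exact hk⟩
  obtain ⟨l, hl⟩ := IsPGroup.iff_card.1 hq
  have hG : Nat.card G = 2 ^ l * t := by
    rw [Subgroup.card_eq_card_quotient_mul_card_subgroup A, hl, hAcard]
  have ht2 : ¬ 2 ∣ t := ht.not_two_dvd_nat
  let S : Sylow 2 G := default
  have hScard : Nat.card S = 2 ^ l := by
    rw [Sylow.card_eq_multiplicity, hG, Nat.factorization_mul (by positivity) (by
      rintro rfl; simp at ht2)]
    simp [Nat.factorization_eq_zero_of_not_dvd ht2, Nat.Prime.factorization Nat.prime_two]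
  set P : Subgroup G := S.toSubgroup
  have hcompl : A.IsComplement' P := by
    refine Subgroup.isComplement'_of_coprime ?_ ?_
    · rw [hAcard, show Nat.card P = 2 ^ l from hScard, hG, mul_comm]
    · rw [hAcard, show Nat.card P = 2 ^ l from hScard]
      exact (Nat.Coprime.pow_left l ((Nat.Prime.coprime_iff_not_dvd Nat.prime_two).2 ht2)).symm
  have hIsCompl := hcompl.isCompl
  -- The Sylow subgroup is normalised by itself and by the central complement `A`.
  have hPn : P.Normal := by
    have : (⊤ : Subgroup G) ≤ Subgroup.normalizer (P : Set G) := by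
      rw [← hIsCompl.sup_eq_top]
      refine sup_le (hAZ.trans (Subgroup.center_le_normalizer _)) Subgroup.le_normalizer
    exact Subgroup.normalizer_eq_top_iff.1 (top_le_iff.1 this)
  refine ⟨A, P, ⟨⟨hAn, hPn, hIsCompl⟩, ⟨inferInstance, hAcard ▸ ht⟩, S.isPGroup', ?_⟩, hAZ⟩
  exact isCyclic_of_injective
    (((P.subtype).comp (Subgroup.center P).subtype).codRestrict (Subgroup.center G)
      fun p => mem_center_of_isCompl hAZ hIsCompl.sup_eq_top p.2)
    fun p q h => by
      have hpq := congrArg Subtype.val h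
      exact Subtype.ext (Subtype.ext hpq)

/-- The centralizer of the noncentral `u` contains the noncommuting `x` and `y`. -/
lemma IsCAGroup.not_hasCommutingNonabelianPairs {G : Type*} [Group G] (hG : IsCAGroup G)
    (P : Subgroup G) : ¬ HasCommutingNonabelianPairs P := by
  rintro ⟨u, v, x, y, huv, hxy, hux, huy, -, -⟩
  refine hxy (Subtype.ext (hG.2 u (fun hu => huv (Subtype.ext ?_)) x ?_ y ?_))
  · exact (Subgroup.mem_center_iff.1 hu v).symm
  · exact Subgroup.mem_centralizer_singleton_iff.2 (congrArg Subtype.val hux.eq.symm)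
  · exact Subgroup.mem_centralizer_singleton_iff.2 (congrArg Subtype.val huy.eq.symm)

lemma nonAbelian_of_isCompl {G : Type*} [Group G] {A P : Subgroup G}
    (hA : A ≤ Subgroup.center G) (hAP : A ⊔ P = ⊤) (hna : NonAbelian G) : NonAbelian P := by
  by_contra h
  simp only [NonAbelian, not_exists, not_not] at h
  obtain ⟨x, y, hxy⟩ := hna
  have hP : P ≤ Subgroup.center G := fun p hp =>
    mem_center_of_isCompl hA hAP (p := ⟨p, hp⟩) (Subgroup.mem_center_iff.2 fun g => h g _)
  have htop : y ∈ Subgroup.center G := sup_le hA hP (hAP ▸ Subgroup.mem_top y)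
  exact hxy (Subgroup.mem_center_iff.1 htop x)

end CentGroups

/-! ### The classification. -/

open CentGroups in
theorem theorem1p4 {G : Type*} [Group G] [Finite G]
    (hna : CentGroups.NonAbelian G)
    (hcent : Nat.card (CentGroups.Cent G) = Nat.card G / Nat.card (Subgroup.center G))
    (hZ : IsCyclic (Subgroup.center G)) :
    (∃ A P : Subgroup G, CentGroups.IsOddCyclicTimesTwoGroup A P ∧
      ((∃ n ε : ℕ, 1 < n ∧ 1 ≤ ε ∧ CentGroups.IsCentralProductOf P
          (CentGroups.Q 2 n 0 :: List.replicate ε (CentGroups.Q 2 1 1))) ∨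
        (∃ n ε : ℕ, 2 < n ∧ CentGroups.IsCentralProductOf P
          (CentGroups.Q 2 n 1 :: List.replicate ε (CentGroups.Q 2 1 1))) ∨
        (∃ ε : ℕ, 1 ≤ ε ∧ CentGroups.IsCentralProductOf P
          (List.replicate ε (CentGroups.Q 2 1 1))) ∨
        (∃ ε : ℕ, CentGroups.IsCentralProductOf P
          (CentGroups.R 1 :: List.replicate ε (CentGroups.Q 2 1 1))))) ∧
    (CentGroups.IsCAGroup G →
      ∃ A P : Subgroup G, CentGroups.IsOddCyclicTimesTwoGroup A P ∧
        ((∃ n : ℕ, 1 < n ∧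
            CentGroups.IsCentralProductOf P [CentGroups.Q 2 n 0, CentGroups.Q 2 1 1]) ∨
          (∃ n : ℕ, 2 < n ∧ CentGroups.IsCentralProductOf P [CentGroups.Q 2 n 1]) ∨
          CentGroups.IsCentralProductOf P [CentGroups.Q 2 1 1] ∨
          CentGroups.IsCentralProductOf P [CentGroups.R 1])) := by
  have hsq := mul_self_mem_center hcent
  obtain ⟨A, P, hAP, hAZ⟩ := exists_odd_times_two_group hsq hZ
  have hsup := hAP.1.2.2.sup_eq_top
  have hsqP : ∀ x : P, x * x ∈ Subgroup.center P := fun x =>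
    Subgroup.mem_center_iff.2 fun g => Subtype.ext (Subgroup.mem_center_iff.1 (hsq x) g)
  have hnaP := nonAbelian_of_isCompl hAZ hsup hna
  obtain ⟨c, m, hcZ, hord, hz, hP⟩ := exists_generator hAP.2.2.1 hAP.2.2.2 hsqP hnaP
  -- The center of `P` has order `2 ^ (m + 1)`, so this separates order two from order at least
  -- four.
  rcases m with - | m
  · rw [pow_zero, pow_one] at hz hP
    rcases decomposition_of_card_center_eq_two hnaP hz hP hcZ hsqP with
      ⟨ε, hε, h, hb⟩ | ⟨ε, h, hb⟩
    · refine ⟨⟨A, P, hAP, .inr (.inr (.inl ⟨ε, hε, h⟩))⟩, fun hCA =>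
        ⟨A, P, hAP, .inr (.inr (.inl ?_))⟩⟩
      obtain rfl : ε = 1 := by
        by_contra hne
        exact hCA.not_hasCommutingNonabelianPairs P (hb (by omega))
      exact h
    · refine ⟨⟨A, P, hAP, .inr (.inr (.inr ⟨ε, h⟩))⟩, fun hCA =>
        ⟨A, P, hAP, .inr (.inr (.inr ?_))⟩⟩
      obtain rfl : ε = 0 := by
        by_contra hne
        exact hCA.not_hasCommutingNonabelianPairs P (hb (by omega))
      exact h
  · rcases decomposition_of_four_le_card_center hnaP hord hz hP hcZ hsqP with
      ⟨n, ε, hn, hε, h, hb⟩ | ⟨n, ε, hn, h, hb⟩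
    · refine ⟨⟨A, P, hAP, .inl ⟨n, ε, hn, hε, h⟩⟩, fun hCA => ⟨A, P, hAP, .inl ⟨n, hn, ?_⟩⟩⟩
      obtain rfl : ε = 1 := by
        by_contra hne
        exact hCA.not_hasCommutingNonabelianPairs P (hb (by omega))
      exact h
    · refine ⟨⟨A, P, hAP, .inr (.inl ⟨n, ε, hn, h⟩)⟩, fun hCA =>
        ⟨A, P, hAP, .inr (.inl ⟨n, hn, ?_⟩)⟩⟩
      obtain rfl : ε = 0 := by
        by_contra hne
        exact hCA.not_hasCommutingNonabelianPairs P (hb (by omega))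
      exact h
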